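/- Let $X$ be a real Banach space of finite cotype, i.e. there are $2\le q<\infty$ and $C<\infty$ with $$\Big(\sum_{j=1}^n\|x_j\|^q\Big)^{1/q}\le C\Big(\operatorname*{Ave}_{\varepsilon_j=\pm1}\Big\|\sum_{j=1}^n\varepsilon_jx_j\Big\|^q\Big)^{1/q}$$ for all $n\in\mathbb N$ and $x_1,\dots,x_n\in X$. Let $(e_n)_{n\ge1}$ be a normalized Schauder basis of $X$ with biorthogonal functionals $(e_n^*)$, let $w=(w_n)_{n\ge1}$ be a sequence of positive real numbers, and write $w(A)=\sum_{n\in A}w_n$ for finite $A\subset\mathbb N$. A greedy ordering of $x\in X$ is an injective map $\rho:\mathbb N\to\mathbb N$ whose range contains $\{n:e_n^*(x)\ne0\}$ and for which $(|e^*_{\rho(i)}(x)|)_{i\ge1}$ is nonincreasing; put $\Lambda_m=\Lambda_{m,\rho}=\{\rho(1),\dots,\rho(m)\}$. Suppose that $(e_n)$ is $w$-semi-greedy: for some choice of a greedy ordering $\rho_x$ of each $x\in X$ there is a constant $\overline K$ such that for all $x\in X$ and $m\ge1$, with $\Lambda_m=\Lambda_{m,\rho_x}$, $$\min\Big\{\Big\|x-\sum_{n\in\Lambda_m}a_ne_n\Big\|:a_n\in\mathbb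 R\Big\}\le\overline K\,\inf\Big\{\Big\|x-\sum_{n\in A}a_ne_n\Big\|:A\subset\mathbb N\text{ finite},\ w(A)\le w(\Lambda_m),\ a_n\in\mathbb R\Big\}.$$ Then $(e_n)$ is $w$-almost greedy: there is a constant $K$ such that for all $x\in X$, every greedy ordering $\tau$ of $x$ and all $m\ge1$, with $\Lambda_m=\Lambda_{m,\tau}$, $$\Big\|x-\sum_{n\in\Lambda_m}e_n^*(x)e_n\Big\|\le K\,\inf\Big\{\Big\|x-\sum_{n\in A}e_n^*(x)e_n\Big\|:A\subset\mathbb N\text{ finite},\ w(A)\le w(\Lambda_m)\Big\}.$$ -/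

import Mathlib

noncomputable section

namespace WeightGreedy

variable {X : Type*} [NormedAddCommGroup X] [NormedSpace ℝ X]

/-- Cotype `q` with constant `C`: for all `x₁, …, xₙ ∈ X`,
`(∑ ‖xⱼ‖ ^ q) ^ (1 / q) ≤ C (Ave_{εⱼ = ±1} ‖∑ εⱼ xⱼ‖ ^ q) ^ (1 / q)`. -/
def HasCotypeWith (X : Type*) [NormedAddCommGroup X] [NormedSpace ℝ X] (q C : ℝ) : Prop :=
  ∀ (n : ℕ) (x : Fin n → X),
    (∑ j, ‖x j‖ ^ q) ^ (1 / q) ≤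
      C * ((∑ ε : Fin n → ℤˣ, ‖∑ j, ((ε j : ℤ) : ℝ) • x j‖ ^ q) / (2 : ℝ) ^ n) ^ (1 / q)

/-- `X` has cotype `q` for some real `2 ≤ q < ∞`. -/
def HasFiniteCotype (X : Type*) [NormedAddCommGroup X] [NormedSpace ℝ X] : Prop :=
  ∃ q C : ℝ, 2 ≤ q ∧ HasCotypeWith X q C

/-- A weight is a sequence of positive real numbers. -/
def IsWeight (w : ℕ → ℝ) : Prop := ∀ n, 0 < w n

/-- The `w`-measure `w(A) = ∑_{n ∈ A} w n` of a finite set of indices. -/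
def wMeasure (w : ℕ → ℝ) (A : Finset ℕ) : ℝ := ∑ n ∈ A, w n

/-- The basis is normalized: all its vectors have norm one. -/
def IsNormalized (e : SchauderBasis ℝ X) : Prop := ∀ n, ‖e n‖ = 1

/-- `ρ` is a greedy ordering for `x`: it enumerates, without repetition, a set of indices
containing the support of `x`, in such a way that the absolute values of the coefficients of `x`
are nonincreasing. Ties may be broken in any way. (`ρ` is not required to be onto: when `x` has
infinitely many nonzero coefficients, the indices of the zero ones are never reached.) -/
structure IsGreedyOrdering (e : SchauderBasis ℝ X) (x : X) (ρ : ℕ → ℕ) : Prop where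
  injective : Function.Injective ρ
  antitone : Antitone fun i => |e.coord (ρ i) x|
  support_subset : ∀ n, e.coord n x ≠ 0 → n ∈ Set.range ρ

/-- The set `Λ_m = {ρ 0, …, ρ (m - 1)}` of the first `m` indices of an ordering. -/
def greedySet (ρ : ℕ → ℕ) (m : ℕ) : Finset ℕ := (Finset.range m).image ρ

/-- The greedy approximant `G_m(x) = ∑_{n ∈ Λ_m} e_n^*(x) e_n` along the ordering `ρ`. -/
def greedyApprox (e : SchauderBasis ℝ X) (ρ : ℕ → ℕ) (m : ℕ) (x : X) : X :=
  ∑ n ∈ greedySet ρ m, e.coord n x • e n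

/-- The error `inf {‖x - ∑_{n ∈ A} e_n^*(x) e_n‖ : w(A) ≤ y}` of the best approximation of `x` by
its own projections on sets of weight at most `y`. -/
def expansionalError (e : SchauderBasis ℝ X) (w : ℕ → ℝ) (y : ℝ) (x : X) : ℝ :=
  sInf {r : ℝ | ∃ A : Finset ℕ, wMeasure w A ≤ y ∧ r = ‖x - ∑ n ∈ A, e.coord n x • e n‖}

/-- The error `σ^w_y(x) = inf {‖x - ∑_{n ∈ A} a_n e_n‖ : w(A) ≤ y, a_n ∈ ℝ}` of the best
approximation of `x` by vectors whose support has weight at most `y`. -/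
def bestError (e : SchauderBasis ℝ X) (w : ℕ → ℝ) (y : ℝ) (x : X) : ℝ :=
  sInf {r : ℝ | ∃ (A : Finset ℕ) (a : ℕ → ℝ), wMeasure w A ≤ y ∧ r = ‖x - ∑ n ∈ A, a n • e n‖}

/-- `v` is a Chebyshev approximation to `x` from the span of the `e n`, `n ∈ Λ`. -/
def IsChebyshevApprox (e : SchauderBasis ℝ X) (Λ : Finset ℕ) (x v : X) : Prop :=
  (∃ a : ℕ → ℝ, v = ∑ n ∈ Λ, a n • e n) ∧
    ∀ a : ℕ → ℝ, ‖x - v‖ ≤ ‖x - ∑ n ∈ Λ, a n • e n‖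

/-- `w`-almost greedy with constant `K`; the inequality is required for every greedy ordering. -/
def IsWAlmostGreedyWith (e : SchauderBasis ℝ X) (w : ℕ → ℝ) (K : ℝ) : Prop :=
  ∀ (x : X) (τ : ℕ → ℕ), IsGreedyOrdering e x τ → ∀ m : ℕ, 1 ≤ m →
    ‖x - greedyApprox e τ m x‖ ≤ K * expansionalError e w (wMeasure w (greedySet τ m)) x

/-- `w`-almost greedy with some constant. -/
def IsWAlmostGreedy (e : SchauderBasis ℝ X) (w : ℕ → ℝ) : Prop :=
  ∃ K : ℝ, IsWAlmostGreedyWith e w K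

/-- `w`-semi-greedy with constant `K`, where `ρ x` is the greedy ordering selected for `x`:
`‖x - Ḡ_m(x)‖ ≤ K σ^w_{w(Λ_m)}(x)`, where `Ḡ_m(x)` is a Chebyshev approximation to `x` from the
span of the `e n`, `n ∈ Λ_m`. (All Chebyshev approximations to `x` have the same error, so it
does not matter which one is taken.) -/
def IsWSemiGreedyWith (e : SchauderBasis ℝ X) (w : ℕ → ℝ) (ρ : X → ℕ → ℕ) (K : ℝ) : Prop :=
  ∀ (x : X) (m : ℕ), 1 ≤ m →
    ∃ v : X, IsChebyshevApprox e (greedySet (ρ x) m) x v ∧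
      ‖x - v‖ ≤ K * bestError e w (wMeasure w (greedySet (ρ x) m)) x

/-- `w`-semi-greedy with some constant, with respect to the selection `ρ` of greedy orderings. -/
def IsWSemiGreedy (e : SchauderBasis ℝ X) (w : ℕ → ℝ) (ρ : X → ℕ → ℕ) : Prop :=
  ∃ K : ℝ, IsWSemiGreedyWith e w ρ K

end WeightGreedy

end

open Filter Topology

namespace WeightGreedy

/-! ### Coordinates and partial-sum projections -/

section Coordinates

variable {X : Type*} [NormedAddCommGroup X] [NormedSpace ℝ X] (e : SchauderBasis ℝ X)

/-! Semi-greediness is used only for sets of strictly largest coefficients, where every greedy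
ordering agrees (`StrictSemiGreedy`). For finitely supported `x`, let `y` and `z` be the residuals
after projecting off `Λ` and `A`, and `t` the threshold of `Λ`. Add `2t` on a set `F` beyond the
support, of weight at least that of the symmetric difference of `Λ` and `A`. Then `F` is the greedy
set, a partial-sum projection recovers `y`, and correcting on the symmetric difference turns `y`
into `z`; so `‖y‖` is controlled by `‖z‖` and `t‖∑_{n ∈ F} e n‖` (`norm_le_add_tail`). The last term
is controlled by `‖z‖`, because `z` is at least `t` in modulus on `Λ \ A` (`norm_tail_le`). If `w`
is summable, heavy distant sets may not exist, but `e 0` then outweighs a whole tail and plays the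
role of `F`. Density gives the general case. -/

theorem coord_basis (i j : ℕ) : e.coord i (e j) = if i = j then 1 else 0 := by
  rw [e.ortho]
  by_cases h : i = j <;> simp [h]

theorem coord_sum (A : Finset ℕ) (a : ℕ → ℝ) (i : ℕ) :
    e.coord i (∑ n ∈ A, a n • e n) = if i ∈ A then a i else 0 := by
  simp [map_sum, coord_basis]

theorem ext_coord {x y : X} (h : ∀ n, e.coord n x = e.coord n y) : x = y := by
  refine tendsto_nhds_unique (SchauderBasis.tendsto_proj e x) ?_
  simpa [h] using! SchauderBasis.tendsto_proj e y

theorem coord_proj (N : ℕ) (x : X) (i : ℕ) :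
    e.coord i (SchauderBasis.proj e N x) = if i < N then e.coord i x else 0 := by
  rw [SchauderBasis.proj_apply, coord_sum]
  simp

theorem exists_norm_proj_apply_le [CompleteSpace X] :
    ∃ M : ℝ, 1 ≤ M ∧ ∀ N x, ‖SchauderBasis.proj e N x‖ ≤ M * ‖x‖ := by
  obtain ⟨C, hC⟩ := SchauderBasis.exists_norm_proj_le e
  refine ⟨max C 1, le_max_right _ _, fun N x => ?_⟩
  refine (ContinuousLinearMap.le_opNorm _ _).trans ?_
  gcongr
  exact (hC N).trans (le_max_left _ _)

variable {e}

theorem abs_coord_le (he : IsNormalized e) {M : ℝ}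
    (hM : ∀ N x, ‖SchauderBasis.proj e N x‖ ≤ M * ‖x‖) (n : ℕ) (x : X) :
    |e.coord n x| ≤ 2 * M * ‖x‖ := by
  have h : e.coord n x • e n = SchauderBasis.proj e (n + 1) x - SchauderBasis.proj e n x := by
    simp [Finset.sum_range_succ]
  have h1 : |e.coord n x| = ‖e.coord n x • e n‖ := by
    rw [norm_smul, he n, mul_one, Real.norm_eq_abs]
  rw [h1, h]
  linarith [norm_sub_le (SchauderBasis.proj e (n + 1) x) (SchauderBasis.proj e n x),
    hM (n + 1) x, hM n x]

/-- Chebyshev approximation from a set of strictly largest coefficients is, up to the factor `K`,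
as good as any approximation supported on a set of no larger weight. -/
def StrictSemiGreedy (e : SchauderBasis ℝ X) (w : ℕ → ℝ) (K : ℝ) : Prop :=
  ∀ (u : X) (G : Finset ℕ), G.Nonempty →
    (∀ n ∈ G, ∀ m ∉ G, |e.coord m u| < |e.coord n u|) →
    ∃ a : ℕ → ℝ, ∀ (A : Finset ℕ) (b : ℕ → ℝ), wMeasure w A ≤ wMeasure w G →
      ‖u - ∑ n ∈ G, a n • e n‖ ≤ K * ‖u - ∑ n ∈ A, b n • e n‖

/-! ### From greedy orderings to strictly dominant sets -/

theorem card_greedySet {ρ : ℕ → ℕ} (hρ : Function.Injective ρ) (m : ℕ) :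
    (greedySet ρ m).card = m := by
  rw [greedySet, Finset.card_image_of_injective _ hρ, Finset.card_range]

/-- By strictness, everything listed before an element of `G` is in `G`, so ties never matter. -/
theorem IsGreedyOrdering.greedySet_card_eq {u : X} {ρ : ℕ → ℕ} (hρ : IsGreedyOrdering e u ρ)
    {G : Finset ℕ} (hG : ∀ n ∈ G, ∀ m ∉ G, |e.coord m u| < |e.coord n u|) :
    greedySet ρ G.card = G := by
  symm
  refine Finset.eq_of_subset_of_card_le (fun n hn => ?_) (card_greedySet hρ.injective _).le
  obtain ⟨m, hm⟩ := Infinite.exists_notMem_finset G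
  obtain ⟨i, rfl⟩ := hρ.support_subset n
    (abs_pos.1 ((abs_nonneg _).trans_lt (hG n hn m hm)))
  refine Finset.mem_image_of_mem _ (Finset.mem_range.2 ?_)
  have hsub : greedySet ρ (i + 1) ⊆ G := by
    intro k hk
    obtain ⟨j, hj, rfl⟩ := Finset.mem_image.1 hk
    by_contra hkG
    exact absurd (hρ.antitone (Nat.lt_succ_iff.1 (Finset.mem_range.1 hj)))
      (not_le.2 (hG _ hn _ hkG))
  have := Finset.card_le_card hsub
  rw [card_greedySet hρ.injective] at this
  omega

theorem bestError_le (w : ℕ → ℝ) {y : ℝ} (x : X) {A : Finset ℕ} (hA : wMeasure w A ≤ y)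
    (a : ℕ → ℝ) : bestError e w y x ≤ ‖x - ∑ n ∈ A, a n • e n‖ := by
  refine csInf_le ⟨0, ?_⟩ ⟨A, a, hA, rfl⟩
  rintro r ⟨_, _, _, rfl⟩
  exact norm_nonneg _

theorem bestError_nonneg (w : ℕ → ℝ) (y : ℝ) (x : X) : 0 ≤ bestError e w y x := by
  refine Real.sInf_nonneg ?_
  rintro r ⟨_, _, _, rfl⟩
  exact norm_nonneg _

theorem IsWSemiGreedy.exists_strictSemiGreedy {w : ℕ → ℝ} {ρ : X → ℕ → ℕ}
    (hρ : ∀ x, IsGreedyOrdering e x (ρ x)) (h : IsWSemiGreedy e w ρ) :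
    ∃ K, 0 ≤ K ∧ StrictSemiGreedy e w K := by
  obtain ⟨K, hK⟩ := h
  refine ⟨max K 0, le_max_right _ _, fun u G hne hG => ?_⟩
  obtain ⟨v, ⟨⟨a, rfl⟩, -⟩, hv⟩ := hK u G.card hne.card_pos
  rw [(hρ u).greedySet_card_eq hG] at hv
  refine ⟨a, fun A b hA => hv.trans ?_⟩
  calc K * bestError e w (wMeasure w G) u ≤ max K 0 * bestError e w (wMeasure w G) u :=
        mul_le_mul_of_nonneg_right (le_max_left _ _) (bestError_nonneg _ _ _)
    _ ≤ _ := mul_le_mul_of_nonneg_left (bestError_le w u hA b) (le_max_right _ _)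

/-! ### Comparison with distant sets -/

/-- A finitely supported vector with coefficients at most `t` is controlled by its distance to
vectors supported on `A`, up to the fundamental vector of a distant set of larger weight. -/
theorem StrictSemiGreedy.norm_le_add_tail {w : ℕ → ℝ} {K M : ℝ} (h : StrictSemiGreedy e w K)
    (hK : 0 ≤ K) (hM1 : 1 ≤ M) (hM : ∀ N x, ‖SchauderBasis.proj e N x‖ ≤ M * ‖x‖)
    {N : ℕ} {y : X} (hy : ∀ n, N ≤ n → e.coord n y = 0) {t : ℝ} (ht : 0 < t)
    (hyt : ∀ n, |e.coord n y| ≤ t) {F : Finset ℕ} (hF : ∀ n ∈ F, N ≤ n) (hne : F.Nonempty)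
    {A : Finset ℕ} (hA : wMeasure w A ≤ wMeasure w F) (b : ℕ → ℝ) :
    ‖y‖ ≤ M * K * (‖y - ∑ n ∈ A, b n • e n‖ + 2 * (t * ‖∑ n ∈ F, e n‖)) := by
  set u : X := y + ∑ n ∈ F, (2 * t) • e n with hu
  have hcu : ∀ i, e.coord i u = e.coord i y + if i ∈ F then 2 * t else 0 := fun i => by
    rw [hu, map_add, coord_sum e F (fun _ => 2 * t)]
  obtain ⟨a, ha⟩ := h u F hne (fun n hn m hm => by
    rw [hcu, hcu, if_pos hn, if_neg hm, hy n (hF n hn), zero_add, add_zero,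
      abs_of_pos (by positivity : (0 : ℝ) < 2 * t)]
    linarith [hyt m])
  -- Whatever the `a n` are, they live on `F`, beyond `N`.
  have hproj : SchauderBasis.proj e N (u - ∑ n ∈ F, a n • e n) = y := by
    refine ext_coord e fun i => ?_
    rw [coord_proj]
    split_ifs with hi
    · have hiF : i ∉ F := fun hiF => absurd (hF i hiF) (not_le.2 hi)
      rw [map_sub, hcu, coord_sum, if_neg hiF, if_neg hiF]
      ring
    · exact (hy i (not_lt.1 hi)).symm
  have h1 := hM N (u - ∑ n ∈ F, a n • e n)
  rw [hproj] at h1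
  have h2 : ‖u - ∑ n ∈ A, b n • e n‖
      ≤ ‖y - ∑ n ∈ A, b n • e n‖ + 2 * (t * ‖∑ n ∈ F, e n‖) := by
    have : u - ∑ n ∈ A, b n • e n
        = (y - ∑ n ∈ A, b n • e n) + (2 * t) • ∑ n ∈ F, e n := by
      rw [hu, Finset.smul_sum]; abel
    rw [this]
    refine (norm_add_le _ _).trans (le_of_eq ?_)
    rw [norm_smul, Real.norm_of_nonneg (by positivity)]
    ring
  calc ‖y‖ ≤ M * ‖u - ∑ n ∈ F, a n • e n‖ := h1
    _ ≤ M * (K * ‖u - ∑ n ∈ A, b n • e n‖) := by gcongr; exact ha A b hA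
    _ ≤ M * (K * (‖y - ∑ n ∈ A, b n • e n‖ + 2 * (t * ‖∑ n ∈ F, e n‖))) := by gcongr
    _ = _ := by ring

/-- Fundamental vectors of distant sets are controlled by vectors with large coefficients on a set
of larger weight. -/
theorem StrictSemiGreedy.norm_tail_le {w : ℕ → ℝ} {K M : ℝ} (h : StrictSemiGreedy e w K)
    (hK : 0 ≤ K) (hM1 : 1 ≤ M) (hM : ∀ N x, ‖SchauderBasis.proj e N x‖ ≤ M * ‖x‖)
    {N : ℕ} {z : X} (hz : ∀ n, N ≤ n → e.coord n z = 0) {t : ℝ} (ht : 0 < t)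
    {B : Finset ℕ} (hne : B.Nonempty) (hBt : ∀ n ∈ B, t ≤ |e.coord n z|)
    (hzt : ∀ n ∉ B, |e.coord n z| ≤ t) {F : Finset ℕ} (hF : ∀ n ∈ F, N ≤ n)
    (hFB : wMeasure w F ≤ wMeasure w B) :
    t * ‖∑ n ∈ F, e n‖ ≤ 2 * (1 + M) * K * ‖z‖ := by
  have hBN : ∀ n ∈ B, n < N := fun n hn => by
    by_contra hnN
    have := hBt n hn
    rw [hz n (not_lt.1 hnN), abs_zero] at this
    linarith
  have hz0 : 0 < ‖z‖ := by
    obtain ⟨n, hn⟩ := hne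
    refine norm_pos_iff.2 fun h0 => ?_
    have := hBt n hn
    rw [h0, map_zero, abs_zero] at this
    linarith
  set p : X := ∑ n ∈ B, e.coord n z • e n with hp
  -- Inflating `z` on `B` by `1 + δ` makes `B` strictly dominant over the value `t` on `F`, at a
  -- cost of at most `‖z‖`.
  set δ : ℝ := ‖z‖ / (‖p‖ + 1) with hδ
  have hδ0 : 0 < δ := by positivity
  have hδp : δ * ‖p‖ ≤ ‖z‖ := by
    rw [hδ, div_mul_eq_mul_div, div_le_iff₀ (by positivity)]
    nlinarith [norm_nonneg p]
  set u : X := z + δ • p + ∑ n ∈ F, t • e n with hu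
  have hcu : ∀ i, e.coord i u = e.coord i z + δ * (if i ∈ B then e.coord i z else 0)
      + if i ∈ F then t else 0 := fun i => by
    rw [hu, map_add, map_add, map_smul, hp, coord_sum, coord_sum e F (fun _ => t), smul_eq_mul]
  have hFB' : ∀ n ∈ F, n ∉ B := fun n hn hB => absurd (hF n hn) (not_le.2 (hBN n hB))
  obtain ⟨a, ha⟩ := h u B hne (fun n hn m hm => by
    have h1 : |e.coord m u| ≤ t := by
      rw [hcu, if_neg hm]
      split_ifs with hmF
      · rw [hz m (hF m hmF)]
        simp [abs_of_pos ht]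
      · simpa using hzt m hm
    have h2 : e.coord n u = (1 + δ) * e.coord n z := by
      rw [hcu, if_pos hn, if_neg fun hnF => hFB' n hnF hn]
      ring
    rw [h2, abs_mul, abs_of_pos (by positivity : 0 < 1 + δ)]
    nlinarith [hBt n hn])
  set v : X := u - ∑ n ∈ B, a n • e n with hv
  -- `B` lies below `N`, so the approximation cannot touch the tail.
  have hvF : v - SchauderBasis.proj e N v = t • ∑ n ∈ F, e n := by
    refine ext_coord e fun i => ?_
    rw [Finset.smul_sum, coord_sum e F (fun _ => t), map_sub, coord_proj]
    split_ifs with hi hiF hiF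
    · exact absurd (hF i hiF) (not_le.2 hi)
    · ring
    · rw [hv, map_sub, hcu, coord_sum, if_neg (hFB' i hiF), if_neg (hFB' i hiF), if_pos hiF,
        hz i (hF i hiF)]
      ring
    · have hiB : i ∉ B := fun hB => hi (hBN i hB)
      rw [hv, map_sub, hcu, coord_sum, if_neg hiB, if_neg hiB, if_neg hiF, hz i (not_lt.1 hi)]
      ring
  have h3 : ‖v‖ ≤ K * (2 * ‖z‖) := by
    refine (ha F (fun _ => t) hFB).trans ?_
    gcongr
    have : u - ∑ n ∈ F, t • e n = z + δ • p := by rw [hu]; abel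
    rw [this]
    refine (norm_add_le _ _).trans ?_
    rw [norm_smul, Real.norm_of_nonneg hδ0.le]
    linarith
  calc t * ‖∑ n ∈ F, e n‖ = ‖v - SchauderBasis.proj e N v‖ := by
        rw [hvF, norm_smul, Real.norm_of_nonneg ht.le]
    _ ≤ ‖v‖ + M * ‖v‖ := (norm_sub_le _ _).trans (by gcongr; exact hM N v)
    _ = (1 + M) * ‖v‖ := by ring
    _ ≤ (1 + M) * (K * (2 * ‖z‖)) := by gcongr
    _ = _ := by ring

/-! ### Divergent and summable weights -/

theorem exists_block {w : ℕ → ℝ} (hw : IsWeight w) (hs : ¬ Summable w) (N : ℕ) {s : ℝ}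
    (hs0 : 0 < s) :
    ∃ k, N ≤ k ∧ wMeasure w (Finset.Ico N k) ≤ s ∧ s ≤ wMeasure w (Finset.Ico N (k + 1)) := by
  classical
  have htop := (not_summable_iff_tendsto_nat_atTop_of_nonneg fun n => (hw n).le).1 hs
  have hex : ∃ j, N ≤ j ∧ s ≤ wMeasure w (Finset.Ico N j) := by
    obtain ⟨j, hj, hNj⟩ := ((htop.eventually_ge_atTop (s + ∑ n ∈ Finset.range N, w n)).and
      (eventually_ge_atTop N)).exists
    refine ⟨j, hNj, ?_⟩
    rw [wMeasure, Finset.sum_Ico_eq_sub _ hNj]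
    linarith
  have hj := Nat.find_spec hex
  obtain hlt | heq := hj.1.lt_or_eq
  · refine ⟨Nat.find hex - 1, by omega, ?_, ?_⟩
    · have := Nat.find_min hex (m := Nat.find hex - 1) (by omega)
      rw [not_and, not_le] at this
      exact (this (by omega)).le
    · rw [Nat.sub_add_cancel (by omega)]
      exact hj.2
  · have := hj.2
    rw [← heq, Finset.Ico_self, wMeasure, Finset.sum_empty] at this
    linarith

/-- If the total weight is finite, finitely supported vectors are bounded by their largest
coefficient. -/
theorem StrictSemiGreedy.exists_norm_le_of_summable {w : ℕ → ℝ} {K M : ℝ} (he : IsNormalized e)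
    (h : StrictSemiGreedy e w K) (hK : 0 ≤ K) (hM1 : 1 ≤ M)
    (hM : ∀ N x, ‖SchauderBasis.proj e N x‖ ≤ M * ‖x‖) (hw : IsWeight w) (hs : Summable w) :
    ∃ C : ℝ, 0 ≤ C ∧ ∀ (N : ℕ) (y : X), (∀ n, N ≤ n → e.coord n y = 0) → ∀ t : ℝ, 0 < t →
      (∀ n, |e.coord n y| ≤ t) → ‖y‖ ≤ C * t := by
  -- Beyond `L`, every finite set weighs less than `{0}`.
  obtain ⟨s, hs'⟩ := summable_iff_vanishing_norm.1 hs (w 0) (hw 0)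
  obtain ⟨L, hL⟩ := (insert 0 s).exists_nat_subset_range
  have hL0 : 0 < L := Finset.mem_range.1 (hL (Finset.mem_insert_self _ _))
  refine ⟨L + (1 + M) * (K * 2), by positivity, fun N y hy t ht hyt => ?_⟩
  set A : Finset ℕ := Finset.range N \ Finset.range L with hA
  have hAw : wMeasure w A ≤ wMeasure w {0} := by
    have hd : Disjoint A s := by
      rw [Finset.disjoint_left]
      intro n hn hns
      exact (Finset.mem_sdiff.1 hn).2 (hL (Finset.mem_insert_of_mem hns))
    simpa [wMeasure] using (le_abs_self _).trans (hs' A hd).le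
  set y' : X := ∑ n ∈ A, e.coord n y • e n with hy'
  set u : X := y' + (2 * t) • e 0 with hu
  have hcu : ∀ i, e.coord i u = (if i ∈ A then e.coord i y else 0)
      + 2 * t * if i = 0 then 1 else 0 := fun i => by
    rw [hu, map_add, hy', coord_sum, map_smul, coord_basis, smul_eq_mul]
  have h0A : 0 ∉ A := fun h0 => (Finset.mem_sdiff.1 h0).2 (Finset.mem_range.2 hL0)
  obtain ⟨a, ha⟩ := h u {0} (Finset.singleton_nonempty 0) (fun n hn m hm => by
    rw [Finset.mem_singleton] at hn hm
    rw [hcu, hcu, hn, if_neg h0A, if_pos rfl, if_neg hm, zero_add, mul_one, mul_zero, add_zero,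
      abs_of_pos (by positivity : (0 : ℝ) < 2 * t)]
    split_ifs
    · linarith [hyt m]
    · rw [abs_zero]; positivity)
  set v : X := u - ∑ n ∈ {0}, a n • e n with hv
  have hvy : v - SchauderBasis.proj e L v = y' := by
    refine ext_coord e fun i => ?_
    rw [map_sub, coord_proj, hy', coord_sum]
    split_ifs with hi hiA hiA
    · exact absurd (Finset.mem_range.2 hi) (Finset.mem_sdiff.1 hiA).2
    · ring
    · have hi0 : i ≠ 0 := by omega
      rw [hv, map_sub, hcu, coord_sum, if_pos hiA, if_neg hi0,
        if_neg (by simpa using hi0)]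
      ring
    · have hi0 : i ≠ 0 := by omega
      rw [hv, map_sub, hcu, coord_sum, if_neg hiA, if_neg hi0,
        if_neg (by simpa using hi0)]
      ring
  have h1 : ‖v‖ ≤ K * (2 * t) := by
    refine (ha A (fun n => e.coord n y) hAw).trans ?_
    have : u - ∑ n ∈ A, e.coord n y • e n = (2 * t) • e 0 := by rw [hu, hy']; abel
    rw [this, norm_smul, he 0, Real.norm_of_nonneg (by positivity), mul_one]
  have h2 : ‖y'‖ ≤ (1 + M) * (K * (2 * t)) := by
    calc ‖y'‖ = ‖v - SchauderBasis.proj e L v‖ := by rw [hvy]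
      _ ≤ ‖v‖ + M * ‖v‖ := (norm_sub_le _ _).trans (by gcongr; exact hM L v)
      _ = (1 + M) * ‖v‖ := by ring
      _ ≤ _ := by gcongr
  have h3 : ‖SchauderBasis.proj e L y‖ ≤ L * t := by
    rw [SchauderBasis.proj_apply]
    refine (norm_sum_le_of_le _ (f := fun i => e.coord i y • e i) (n := fun _ => t)
      fun n _ => ?_).trans (by simp)
    rw [norm_smul, he n, mul_one]
    exact hyt n
  have h4 : y = SchauderBasis.proj e L y + y' := by
    refine ext_coord e fun i => ?_
    rw [map_add, coord_proj, hy', coord_sum]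
    by_cases hiL : i < L
    · simp [hA, hiL]
    · by_cases hiN : i < N
      · simp [hA, hiL, hiN]
      · simp [hA, hiL, hiN, hy i (not_lt.1 hiN)]
  rw [h4]
  refine (norm_add_le _ _).trans ?_
  linarith

/-- The block overshoots `w(B)` only by its last index: `norm_tail_le` handles the rest, and the
last vector costs `t ≤ 2M‖z‖`. -/
theorem StrictSemiGreedy.norm_block_le {w : ℕ → ℝ} {K M : ℝ} (he : IsNormalized e)
    (h : StrictSemiGreedy e w K) (hK : 0 ≤ K) (hM1 : 1 ≤ M)
    (hM : ∀ N x, ‖SchauderBasis.proj e N x‖ ≤ M * ‖x‖) (hw : IsWeight w) (hs : ¬ Summable w)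
    {N : ℕ} {z : X} (hz : ∀ n, N ≤ n → e.coord n z = 0) {t : ℝ} (ht : 0 < t)
    {B : Finset ℕ} (hne : B.Nonempty) (hBt : ∀ n ∈ B, t ≤ |e.coord n z|)
    (hzt : ∀ n ∉ B, |e.coord n z| ≤ t) :
    ∃ k, N < k ∧ wMeasure w B ≤ wMeasure w (Finset.Ico N k) ∧
      t * ‖∑ n ∈ Finset.Ico N k, e n‖ ≤ (2 * (1 + M) * K + 2 * M) * ‖z‖ := by
  obtain ⟨k, hNk, hk1, hk2⟩ := exists_block hw hs N (s := wMeasure w B)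
    (Finset.sum_pos (fun n _ => hw n) hne)
  refine ⟨k + 1, Nat.lt_succ_of_le hNk, hk2, ?_⟩
  have h1 := h.norm_tail_le hK hM1 hM hz ht hne hBt hzt
    (fun n hn => (Finset.mem_Ico.1 hn).1) hk1
  obtain ⟨n, hn⟩ := hne
  have h2 : t ≤ 2 * M * ‖z‖ := (hBt n hn).trans (abs_coord_le he hM n z)
  rw [Finset.sum_Ico_succ_top hNk]
  have h3 := norm_add_le (∑ n ∈ Finset.Ico N k, e n) (e k)
  rw [he k] at h3
  nlinarith [mul_le_mul_of_nonneg_left h3 ht.le]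

/-! ### The almost greedy inequality -/

theorem coord_sub_sum (A : Finset ℕ) (x : X) (i : ℕ) :
    e.coord i (x - ∑ n ∈ A, e.coord n x • e n) = if i ∈ A then 0 else e.coord i x := by
  rw [map_sub, coord_sum]
  split_ifs <;> ring

/-- The almost greedy inequality for finitely supported vectors. -/
theorem StrictSemiGreedy.exists_norm_sub_le {w : ℕ → ℝ} {K M : ℝ} (he : IsNormalized e)
    (h : StrictSemiGreedy e w K) (hK : 0 ≤ K) (hM1 : 1 ≤ M)
    (hM : ∀ N x, ‖SchauderBasis.proj e N x‖ ≤ M * ‖x‖) (hw : IsWeight w) :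
    ∃ C : ℝ, 0 ≤ C ∧ ∀ (N : ℕ) (x : X), (∀ n, N ≤ n → e.coord n x = 0) → ∀ (t : ℝ)
      (Λ A : Finset ℕ), (∀ n ∈ Λ, t ≤ |e.coord n x|) → (∀ n ∉ Λ, |e.coord n x| ≤ t) →
      wMeasure w A ≤ wMeasure w Λ →
      ‖x - ∑ n ∈ Λ, e.coord n x • e n‖ ≤ C * ‖x - ∑ n ∈ A, e.coord n x • e n‖ := by
  suffices H : ∃ C : ℝ, 0 ≤ C ∧ ∀ (N : ℕ) (x : X), (∀ n, N ≤ n → e.coord n x = 0) → ∀ (t : ℝ)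
      (Λ A : Finset ℕ), 0 < t → (Λ \ A).Nonempty →
      (∀ n ∈ Λ, t ≤ |e.coord n x|) → (∀ n ∉ Λ, |e.coord n x| ≤ t) →
      wMeasure w A ≤ wMeasure w Λ →
      ‖x - ∑ n ∈ Λ, e.coord n x • e n‖ ≤ C * ‖x - ∑ n ∈ A, e.coord n x • e n‖ by
    obtain ⟨C, hC, H⟩ := H
    refine ⟨C + 1, by positivity, fun N x hx t Λ A h1 h2 hA => ?_⟩
    obtain ht | ht := le_or_gt t 0
    · have : x - ∑ n ∈ Λ, e.coord n x • e n = 0 := by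
        refine ext_coord e fun i => ?_
        rw [coord_sub_sum, map_zero]
        split_ifs with hi
        · rfl
        · exact abs_nonpos_iff.1 ((h2 i hi).trans ht)
      rw [this, norm_zero]
      positivity
    obtain hne | hne := (Λ \ A).eq_empty_or_nonempty
    · have hsub : Λ ⊆ A := Finset.sdiff_eq_empty_iff_subset.1 hne
      have hEq : Λ = A := by
        by_contra hneq
        obtain ⟨i, hiA, hiΛ⟩ := Finset.exists_of_ssubset (hsub.ssubset_of_ne hneq)
        exact absurd hA (not_le.2 (Finset.sum_lt_sum_of_subset hsub hiA hiΛ (hw i)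
          fun j _ _ => (hw j).le))
      rw [hEq]
      nlinarith [norm_nonneg (x - ∑ n ∈ A, e.coord n x • e n)]
    · refine (H N x hx t Λ A ht hne h1 h2 hA).trans ?_
      gcongr
      linarith
  have hkey : ∀ (N : ℕ) (x : X), (∀ n, N ≤ n → e.coord n x = 0) → ∀ A : Finset ℕ, ∀ n, N ≤ n →
      e.coord n (x - ∑ n ∈ A, e.coord n x • e n) = 0 := fun N x hx A n hn => by
    rw [coord_sub_sum, hx n hn, ite_self]
  have hyt : ∀ (x : X) (t : ℝ) (Λ : Finset ℕ), 0 < t → (∀ n ∉ Λ, |e.coord n x| ≤ t) →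
      ∀ n, |e.coord n (x - ∑ n ∈ Λ, e.coord n x • e n)| ≤ t := fun x t Λ ht h2 n => by
    rw [coord_sub_sum]
    split_ifs with hn
    · rw [abs_zero]; exact ht.le
    · exact h2 n hn
  by_cases hs : Summable w
  · obtain ⟨C, hC, hCs⟩ := h.exists_norm_le_of_summable he hK hM1 hM hw hs
    refine ⟨C * (2 * M), by positivity, fun N x hx t Λ A ht hne h1 h2 hA => ?_⟩
    refine (hCs N _ (hkey N x hx Λ) t ht (hyt x t Λ ht h2)).trans ?_
    obtain ⟨n, hn⟩ := hne
    obtain ⟨hnΛ, hnA⟩ := Finset.mem_sdiff.1 hn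
    have h3 := abs_coord_le he hM n (x - ∑ n ∈ A, e.coord n x • e n)
    rw [coord_sub_sum, if_neg hnA] at h3
    rw [mul_assoc]
    gcongr
    exact (h1 n hnΛ).trans h3
  · set D : ℝ := 2 * (1 + M) * K + 2 * M with hD
    refine ⟨M * K * (1 + 4 * D), by positivity, fun N x hx t Λ A ht hne h1 h2 hA => ?_⟩
    set y : X := x - ∑ n ∈ Λ, e.coord n x • e n with hy
    set z : X := x - ∑ n ∈ A, e.coord n x • e n with hz
    have hzN : ∀ n, N ≤ n → e.coord n z = 0 := hkey N x hx A
    have hBt : ∀ n ∈ Λ \ A, t ≤ |e.coord n z| := fun n hn => by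
      obtain ⟨hnΛ, hnA⟩ := Finset.mem_sdiff.1 hn
      rw [hz, coord_sub_sum, if_neg hnA]
      exact h1 n hnΛ
    have hzt : ∀ n ∉ Λ \ A, |e.coord n z| ≤ t := fun n hn => by
      rw [hz, coord_sub_sum]
      split_ifs with hnA
      · rw [abs_zero]; exact ht.le
      · exact h2 n fun hnΛ => hn (Finset.mem_sdiff.2 ⟨hnΛ, hnA⟩)
    -- Two consecutive blocks are needed: the symmetric difference weighs up to `2 w(Λ \ A)`.
    obtain ⟨k, hNk, hk, hk'⟩ := h.norm_block_le he hK hM1 hM hw hs hzN ht hne hBt hzt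
    obtain ⟨l, hkl, hl, hl'⟩ := h.norm_block_le he hK hM1 hM hw hs
      (fun n hn => hzN n (hNk.le.trans hn)) ht hne hBt hzt
    have hw1 : wMeasure w (Finset.Ico N l)
        = wMeasure w (Finset.Ico N k) + wMeasure w (Finset.Ico k l) :=
      (Finset.sum_Ico_consecutive _ hNk.le hkl.le).symm
    have hAΛ : wMeasure w (A \ Λ) ≤ wMeasure w (Λ \ A) := by
      have e1 := Finset.sum_inter_add_sum_sdiff A Λ w
      have e2 := Finset.sum_inter_add_sum_sdiff Λ A w
      rw [Finset.inter_comm] at e2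
      simp only [wMeasure] at hA ⊢
      linarith
    have hdisj : Disjoint (Λ \ A) (A \ Λ) := by
      rw [Finset.disjoint_left]
      intro n h1 h2
      exact (Finset.mem_sdiff.1 h1).2 (Finset.mem_sdiff.1 h2).1
    have hw2 : wMeasure w ((Λ \ A) ∪ (A \ Λ)) ≤ wMeasure w (Finset.Ico N l) := by
      rw [wMeasure, Finset.sum_union hdisj]
      simp only [wMeasure] at hw1 hAΛ hk hl ⊢
      linarith
    have h3 := h.norm_le_add_tail hK hM1 hM (hkey N x hx Λ) ht (hyt x t Λ ht h2)
      (fun n hn => (Finset.mem_Ico.1 hn).1) (Finset.nonempty_Ico.2 (hNk.trans hkl)) hw2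
      -- These coefficients delete `A \ Λ` from `y` and restore `Λ \ A`, yielding `z`.
      (fun n => if n ∈ A then e.coord n x else - e.coord n x)
    have hyz : y - ∑ n ∈ (Λ \ A) ∪ (A \ Λ),
        (if n ∈ A then e.coord n x else - e.coord n x) • e n = z := by
      refine ext_coord e fun i => ?_
      rw [map_sub, hy, hz, coord_sub_sum, coord_sub_sum,
        coord_sum e _ (fun n => if n ∈ A then e.coord n x else - e.coord n x)]
      by_cases hiA : i ∈ A <;> by_cases hiΛ : i ∈ Λ <;> simp [hiA, hiΛ]
    rw [hyz] at h3
    have h4 : t * ‖∑ n ∈ Finset.Ico N l, e n‖ ≤ 2 * D * ‖z‖ := by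
      rw [← Finset.sum_Ico_consecutive _ hNk.le hkl.le]
      have := mul_le_mul_of_nonneg_left
        (norm_add_le (∑ n ∈ Finset.Ico N k, e n) (∑ n ∈ Finset.Ico k l, e n)) ht.le
      linarith
    refine h3.trans ?_
    rw [mul_assoc (M * K)]
    gcongr
    linarith

theorem IsGreedyOrdering.exists_threshold {x : X} {τ : ℕ → ℕ} (hτ : IsGreedyOrdering e x τ)
    {m : ℕ} (hm : 1 ≤ m) :
    ∃ t, 0 ≤ t ∧ (∀ n ∈ greedySet τ m, t ≤ |e.coord n x|) ∧
      ∀ n ∉ greedySet τ m, |e.coord n x| ≤ t := by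
  refine ⟨|e.coord (τ (m - 1)) x|, abs_nonneg _, fun n hn => ?_, fun n hn => ?_⟩
  · obtain ⟨i, hi, rfl⟩ := Finset.mem_image.1 hn
    have := Finset.mem_range.1 hi
    exact hτ.antitone (by omega)
  · by_cases h0 : e.coord n x = 0
    · rw [h0, abs_zero]; exact abs_nonneg _
    · obtain ⟨i, rfl⟩ := hτ.support_subset n h0
      have hi : ¬ i < m := fun hi => hn (Finset.mem_image_of_mem _ (Finset.mem_range.2 hi))
      exact hτ.antitone (by omega)

/-- A Schauder basis of a Banach space with the strict semi-greedy property is almost greedy. -/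
theorem StrictSemiGreedy.isWAlmostGreedy [CompleteSpace X] {w : ℕ → ℝ} {K : ℝ}
    (he : IsNormalized e) (h : StrictSemiGreedy e w K) (hK : 0 ≤ K) (hw : IsWeight w) :
    IsWAlmostGreedy e w := by
  obtain ⟨M, hM1, hM⟩ := exists_norm_proj_apply_le e
  obtain ⟨C, hC, H⟩ := h.exists_norm_sub_le he hK hM1 hM hw
  refine ⟨C, fun x τ hτ m hm => ?_⟩
  obtain ⟨t, ht, h1, h2⟩ := hτ.exists_threshold hm
  have key : ∀ A : Finset ℕ, wMeasure w A ≤ wMeasure w (greedySet τ m) →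
      ‖x - greedyApprox e τ m x‖ ≤ C * ‖x - ∑ n ∈ A, e.coord n x • e n‖ := by
    intro A hA
    have hlim : ∀ v : X, Tendsto (fun N => ‖SchauderBasis.proj e N x - v‖) atTop (𝓝 ‖x - v‖) :=
      fun v => ((SchauderBasis.tendsto_proj e x).sub_const v).norm
    refine le_of_tendsto_of_tendsto (hlim _) ((hlim _).const_mul C) ?_
    -- Once `N` passes `Λ ∪ A`, truncation alters neither projection, and `t` remains a threshold.
    obtain ⟨L, hL⟩ := (greedySet τ m ∪ A).exists_nat_subset_range
    filter_upwards [eventually_ge_atTop L] with N hN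
    have hlt : ∀ n ∈ greedySet τ m ∪ A, n < N := fun n hn =>
      (Finset.mem_range.1 (hL hn)).trans_le hN
    have hsum : ∀ B ⊆ greedySet τ m ∪ A,
        ∑ n ∈ B, e.coord n (SchauderBasis.proj e N x) • e n = ∑ n ∈ B, e.coord n x • e n :=
      fun B hB => Finset.sum_congr rfl fun n hn => by rw [coord_proj, if_pos (hlt n (hB hn))]
    have := H N (SchauderBasis.proj e N x)
      (fun n hn => by rw [coord_proj, if_neg (not_lt.2 hn)]) t (greedySet τ m) A
      (fun n hn => by
        rw [coord_proj, if_pos (hlt n (Finset.mem_union_left _ hn))]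
        exact h1 n hn)
      (fun n hn => by
        rw [coord_proj]
        split_ifs
        · exact h2 n hn
        · rwa [abs_zero]) hA
    rwa [hsum _ Finset.subset_union_left, hsum _ Finset.subset_union_right] at this
  rw [expansionalError, ← smul_eq_mul, ← Real.sInf_smul_of_nonneg hC]
  refine le_csInf ?_ ?_
  · exact Set.Nonempty.smul_set ⟨_, ∅, Finset.sum_nonneg fun n _ => (hw n).le, rfl⟩
  · rintro _ ⟨_, ⟨A, hA, rfl⟩, rfl⟩
    exact key A hA

end Coordinates

end WeightGreedy

theorem mainTheorem3 {X : Type*} [NormedAddCommGroup X] [NormedSpace ℝ X] [CompleteSpace X]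
    (hX : WeightGreedy.HasFiniteCotype X)
    (e : SchauderBasis ℝ X) (he : WeightGreedy.IsNormalized e)
    (w : ℕ → ℝ) (hw : WeightGreedy.IsWeight w)
    (ρ : X → ℕ → ℕ) (hρ : ∀ x : X, WeightGreedy.IsGreedyOrdering e x (ρ x))
    (hsemi : WeightGreedy.IsWSemiGreedy e w ρ) :
    WeightGreedy.IsWAlmostGreedy e w := by
  obtain ⟨K, hK, h⟩ := hsemi.exists_strictSemiGreedy hρ
  exact h.isWAlmostGreedy he hK hw
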